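/- **Theorem.** For every integer $n \ge 10$ there is a maximum packing of $K_n$ with $8$-cycles that is not almost $2$-perfect. Here a *packing* of $K_n$ with $8$-cycles is a collection $\mathcal{C}$ of pairwise edge-disjoint $8$-cycles of $K_n$; its *leave* $\mathcal{L}$ is the set of edges of $K_n$ that lie in no cycle of $\mathcal{C}$, and the packing is *maximum* if $|\mathcal{L}|$ is smallest possible among all packings of $K_n$ with $8$-cycles. An *inside $8$-cycle* of an $8$-cycle $C$ is an $8$-cycle on the same vertex set as $C$ that is edge-disjoint from $C$. A packing $\mathcal{C}$ with leave $\mathcal{L}$ is *almost $2$-perfect* if one can choose an inside $8$-cycle of each cycle in $\mathcal{C}$ so that the chosen $8$-cycles form a packing of $K_n$ with the same leave $\mathcal{L}$. -/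

import Mathlib

namespace CyclePacking

variable {V : Type*} [DecidableEq V]

/-- The edge set of the closed walk `(c 0, c 1, …, c 7)`; the addition `i + 1` is modulo `8`. -/
def cycleEdges (c : Fin 8 → V) : Finset (Sym2 V) :=
  Finset.univ.image fun i : Fin 8 => s(c i, c (i + 1))

/-- An `8`-cycle of the complete graph on `V`, given by its edge set: it is
`(c 0, c 1, …, c 7)` for eight distinct vertices `c 0, …, c 7`. -/
def IsEightCycle (C : Finset (Sym2 V)) : Prop :=
  ∃ c : Fin 8 → V, Function.Injective c ∧ C = cycleEdges c

/-- The set of vertices that lie on some edge of `C`. -/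
def vertexSet (C : Finset (Sym2 V)) : Set V :=
  {v | ∃ e ∈ C, v ∈ e}

/-- `D` is an inside `8`-cycle of `C`: an `8`-cycle on the same vertex set which is edge-disjoint
from `C`. -/
def IsInsideCycle (C D : Finset (Sym2 V)) : Prop :=
  IsEightCycle D ∧ vertexSet D = vertexSet C ∧ Disjoint C D

/-- A packing of the complete graph on `V` with `8`-cycles: a collection of pairwise edge-disjoint
`8`-cycles. -/
def IsPacking (𝒞 : Finset (Finset (Sym2 V))) : Prop :=
  (∀ C ∈ 𝒞, IsEightCycle C) ∧ ∀ C ∈ 𝒞, ∀ D ∈ 𝒞, C ≠ D → Disjoint C D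

/-- The leave: the edges of the complete graph on `V` that lie in none of the cycles. -/
def leave [Fintype V] (𝒞 : Finset (Finset (Sym2 V))) : Finset (Sym2 V) :=
  (⊤ : SimpleGraph V).edgeFinset \ 𝒞.biUnion id

/-- A maximum packing: a packing whose leave has the least possible number of edges. -/
def IsMaximumPacking [Fintype V] (𝒞 : Finset (Finset (Sym2 V))) : Prop :=
  IsPacking 𝒞 ∧
    ∀ 𝒟 : Finset (Finset (Sym2 V)), IsPacking 𝒟 → (leave 𝒞).card ≤ (leave 𝒟).card

/-- A packing is almost `2`-perfect if one can choose an inside `8`-cycle `f C` of each of its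
cycles `C` so that the chosen cycles form a packing with the same leave. (Comparing numbers of
edges, equality of the leaves forces distinct cycles to get distinct inside cycles.) -/
def IsAlmostTwoPerfect [Fintype V] (𝒞 : Finset (Finset (Sym2 V))) : Prop :=
  ∃ f : Finset (Sym2 V) → Finset (Sym2 V),
    (∀ C ∈ 𝒞, IsInsideCycle C (f C)) ∧
      IsPacking (𝒞.image f) ∧ leave (𝒞.image f) = leave 𝒞

end CyclePacking

/-! ### Parity of degrees and the size of the leave -/

namespace CyclePacking

/-! The obstruction is a rigid pair: vertices `u`, `v` whose edge is covered by the packing and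
which occur together in no cycle other than the one through `uv`. If inside cycles with the same
leave could be chosen, one of them would contain `uv`. It has the vertices of its original cycle
`C`, so `C` passes through `u` and `v`, hence contains `uv` by rigidity, although the two cycles are
edge-disjoint (`not_isAlmostTwoPerfect_of_isRigidPair`).

For `n ≥ 11` it remains to find maximum packings with a rigid pair. Explicit tables settle the
orders 11 to 19, 21, 23 and 25. Larger orders follow by adding 16 vertices for odd `n` and 8 for
even `n` (`RigidlyPackable.add_sixteen`, `RigidlyPackable.add_eight`); the new edges are split into
complete bipartite graphs and a small clique so that no new cycle contains both `u` and `v`.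

Maximality is arithmetic. Leaves of packings of the same `K_n` have sizes congruent modulo 8. For
even `n` all degrees of the leave are odd, so it has at least `n / 2` edges; for odd `n` they are
even, so it is empty or has at least three edges.

The order 10 admits no maximum packing with a rigid pair. There, an exhaustive search through the
inside cycles of one explicit packing shows that no choice is edge-disjoint. -/

lemma cycleEdges_injective {V : Type*} {c : Fin 8 → V} (hc : Function.Injective c) :
    Function.Injective fun i : Fin 8 => s(c i, c (i + 1)) := by
  intro i j hij
  rcases Sym2.eq_iff.1 hij with ⟨h, -⟩ | ⟨h1, h2⟩
  · exact hc h
  · have h1 := hc h1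
    have h2 := hc h2
    omega

variable {V : Type*} [DecidableEq V]

lemma card_cycleEdges {c : Fin 8 → V} (hc : Function.Injective c) : (cycleEdges c).card = 8 := by
  rw [cycleEdges, Finset.card_image_of_injective _ (cycleEdges_injective hc)]
  simp

lemma mem_cycleEdges {c : Fin 8 → V} {e : Sym2 V} :
    e ∈ cycleEdges c ↔ ∃ i, s(c i, c (i + 1)) = e := by
  simp [cycleEdges]

lemma mem_vertexSet_cycleEdges {c : Fin 8 → V} {v : V} :
    v ∈ vertexSet (cycleEdges c) ↔ ∃ i, c i = v := by
  constructor
  · rintro ⟨e, he, hv⟩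
    obtain ⟨i, rfl⟩ := mem_cycleEdges.1 he
    rcases Sym2.mem_iff.1 hv with rfl | rfl
    exacts [⟨_, rfl⟩, ⟨_, rfl⟩]
  · rintro ⟨i, rfl⟩
    exact ⟨_, mem_cycleEdges.2 ⟨i, rfl⟩, Sym2.mem_mk_left _ _⟩

lemma IsEightCycle.card_eq {C : Finset (Sym2 V)} (hC : IsEightCycle C) : C.card = 8 := by
  obtain ⟨c, hc, rfl⟩ := hC
  exact card_cycleEdges hc

lemma IsEightCycle.not_isDiag {C : Finset (Sym2 V)} (hC : IsEightCycle C) {e : Sym2 V}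
    (he : e ∈ C) : ¬ e.IsDiag := by
  obtain ⟨c, hc, rfl⟩ := hC
  obtain ⟨i, rfl⟩ := mem_cycleEdges.1 he
  rw [Sym2.mk_isDiag_iff]
  intro h
  have := hc h
  omega

/-- Every vertex has even degree in an `8`-cycle. -/
lemma IsEightCycle.even_card_filter {C : Finset (Sym2 V)} (hC : IsEightCycle C) (v : V) :
    Even (C.filter fun e => v ∈ e).card := by
  have hdiag := fun e he => hC.not_isDiag (e := e) he
  obtain ⟨c, hc, rfl⟩ := hC
  have h1 : ((cycleEdges c).filter fun e => v ∈ e).card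
      = ∑ i : Fin 8, ((if c i = v then 1 else 0) + (if c (i + 1) = v then 1 else 0)) := by
    rw [Finset.card_filter, cycleEdges,
      Finset.sum_image fun i _ j _ h => cycleEdges_injective hc h]
    refine Finset.sum_congr rfl fun i _ => ?_
    have : c i ≠ c (i + 1) := fun h => hdiag _ (mem_cycleEdges.2 ⟨i, rfl⟩) h
    simp only [Sym2.mem_iff]
    by_cases h1 : c i = v <;> by_cases h2 : c (i + 1) = v <;> simp_all [eq_comm]
  -- A cyclic shift of the index identifies the two halves of the degree count, so the degree is
  -- twice a number.
  have h2 : ∑ i : Fin 8, (if c (i + 1) = v then 1 else 0)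
      = ∑ i : Fin 8, (if c i = v then 1 else 0) :=
    Fintype.sum_equiv (Equiv.addRight 1) _ _ fun i => rfl
  rw [h1, Finset.sum_add_distrib, h2]
  exact ⟨_, rfl⟩

lemma IsPacking.card_biUnion {𝒞 : Finset (Finset (Sym2 V))} (h : IsPacking 𝒞) :
    (𝒞.biUnion id).card = 8 * 𝒞.card := by
  have h1 : (𝒞.biUnion id).card = ∑ C ∈ 𝒞, C.card := Finset.card_biUnion h.2
  rw [h1, Finset.sum_congr rfl fun C hC => (h.1 C hC).card_eq]
  simp [mul_comm]

variable [Fintype V]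

lemma IsPacking.biUnion_subset {𝒞 : Finset (Finset (Sym2 V))} (h : IsPacking 𝒞) :
    𝒞.biUnion id ⊆ (⊤ : SimpleGraph V).edgeFinset := by
  intro e he
  obtain ⟨C, hC, heC⟩ := Finset.mem_biUnion.1 he
  simpa using (h.1 C hC).not_isDiag heC

lemma IsPacking.card_leave {𝒞 : Finset (Finset (Sym2 V))} (h : IsPacking 𝒞) :
    (leave 𝒞).card + 8 * 𝒞.card = (Fintype.card V).choose 2 := by
  rw [leave, ← h.card_biUnion, Finset.card_sdiff_add_card_eq_card h.biUnion_subset,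
    SimpleGraph.card_edgeFinset_top_eq_card_choose_two]

/-- The degrees of the leave have the parity of the degrees of the complete graph. -/
lemma IsPacking.even_degree_leave_iff {𝒞 : Finset (Finset (Sym2 V))} (h : IsPacking 𝒞) (v : V) :
    Even ((leave 𝒞).filter fun e => v ∈ e).card ↔ Even (Fintype.card V - 1) := by
  have h1 : ((⊤ : SimpleGraph V).edgeFinset.filter fun e => v ∈ e).card = Fintype.card V - 1 := by
    rw [← SimpleGraph.complete_graph_degree v, ← SimpleGraph.card_incidenceFinset_eq_degree,
      SimpleGraph.incidenceFinset_eq_filter]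
  have h2 : Even ((𝒞.biUnion id).filter fun e => v ∈ e).card := by
    rw [Finset.filter_biUnion, Finset.card_biUnion]
    · exact Finset.even_sum _ fun C hC => (h.1 C hC).even_card_filter v
    · intro C hC D hD hne
      exact (h.2 C hC D hD hne).mono (Finset.filter_subset _ _) (Finset.filter_subset _ _)
  have h3 : ((leave 𝒞).filter fun e => v ∈ e).card + ((𝒞.biUnion id).filter fun e => v ∈ e).card
      = Fintype.card V - 1 := by
    rw [← h1, ← Finset.card_union_of_disjoint, ← Finset.filter_union, leave,
      Finset.sdiff_union_of_subset h.biUnion_subset]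
    exact Finset.disjoint_filter_filter (Finset.sdiff_disjoint)
  rw [← h3, Nat.even_add]
  tauto

lemma not_isDiag_of_mem_leave {𝒞 : Finset (Finset (Sym2 V))} {e : Sym2 V} (he : e ∈ leave 𝒞) :
    ¬ e.IsDiag := by
  simpa using (Finset.mem_sdiff.1 he).1

/-- All degrees of the leave are odd, hence positive, so its edges cover every vertex, and an edge
covers only two. -/
lemma IsPacking.card_le_two_mul_card_leave {𝒞 : Finset (Finset (Sym2 V))} (h : IsPacking 𝒞)
    (hV : Even (Fintype.card V)) : Fintype.card V ≤ 2 * (leave 𝒞).card := by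
  have hsub : (Finset.univ : Finset V) ⊆ (leave 𝒞).biUnion Sym2.toFinset := by
    intro v _
    have hpos : 0 < Fintype.card V := Fintype.card_pos_iff.2 ⟨v⟩
    have hodd : ¬ Even ((leave 𝒞).filter fun e => v ∈ e).card := by
      rw [h.even_degree_leave_iff]
      grind
    have hne : ((leave 𝒞).filter fun e => v ∈ e).Nonempty := by
      rw [← Finset.card_pos, Nat.pos_iff_ne_zero]
      intro h0
      simp [h0] at hodd
    obtain ⟨e, he⟩ := hne
    rw [Finset.mem_filter] at he
    exact Finset.mem_biUnion.2 ⟨e, he.1, Sym2.mem_toFinset.2 he.2⟩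
  calc Fintype.card V = (Finset.univ : Finset V).card := rfl
    _ ≤ ((leave 𝒞).biUnion Sym2.toFinset).card := Finset.card_le_card hsub
    _ ≤ (leave 𝒞).card * 2 := Finset.card_biUnion_le_card_mul _ _ _ fun e _ => by
        rw [Sym2.card_toFinset]; split_ifs <;> omega
    _ = 2 * (leave 𝒞).card := mul_comm _ _

/-- All degrees of the leave are even, so an edge `ab` of it forces a second edge at `a` and a
second one at `b`. These differ, since an edge through both `a` and `b` is `ab` itself. -/
lemma IsPacking.leave_eq_empty_or_three_le {𝒞 : Finset (Finset (Sym2 V))} (h : IsPacking 𝒞)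
    (hV : Odd (Fintype.card V)) : leave 𝒞 = ∅ ∨ 3 ≤ (leave 𝒞).card := by
  have hdeg : ∀ v, Even ((leave 𝒞).filter fun e => v ∈ e).card := fun v => by
    rw [h.even_degree_leave_iff]
    grind
  have hother : ∀ e ∈ leave 𝒞, ∀ v ∈ e, ∃ e' ∈ leave 𝒞, v ∈ e' ∧ e' ≠ e := by
    intro e he v hv
    have hmem : e ∈ (leave 𝒞).filter fun e => v ∈ e := Finset.mem_filter.2 ⟨he, hv⟩
    have : 1 < ((leave 𝒞).filter fun e => v ∈ e).card := by
      have h1 := Finset.card_pos.2 ⟨e, hmem⟩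
      have h2 := hdeg v
      grind
    obtain ⟨e', he', hne⟩ := Finset.exists_mem_ne this e
    rw [Finset.mem_filter] at he'
    exact ⟨e', he'.1, he'.2, hne⟩
  rcases (leave 𝒞).eq_empty_or_nonempty with h0 | ⟨e, he⟩
  · exact Or.inl h0
  right
  induction e with | _ a b
  have hab : a ≠ b := not_isDiag_of_mem_leave he
  obtain ⟨e₁, he₁, ha, h1⟩ := hother _ he a (Sym2.mem_mk_left _ _)
  obtain ⟨e₂, he₂, hb, h2⟩ := hother _ he b (Sym2.mem_mk_right _ _)
  have h12 : e₁ ≠ e₂ := by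
    rintro rfl
    exact h1 ((Sym2.mem_and_mem_iff hab).1 ⟨ha, hb⟩)
  rw [← Finset.card_eq_three.2 ⟨_, _, _, h1.symm, h2.symm, h12, rfl⟩]
  apply Finset.card_le_card
  simp [Finset.insert_subset_iff, he, he₁, he₂]

/-- A smaller leave would be smaller by at least 8, which takes it below half the number of
vertices. -/
lemma IsPacking.isMaximumPacking_of_even {𝒞 : Finset (Finset (Sym2 V))} (h : IsPacking 𝒞)
    (hV : Even (Fintype.card V)) (hl : 2 * (leave 𝒞).card < Fintype.card V + 16) :
    IsMaximumPacking 𝒞 := by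
  refine ⟨h, fun 𝒟 h𝒟 => ?_⟩
  have := h.card_leave
  have := h𝒟.card_leave
  have := h𝒟.card_le_two_mul_card_leave hV
  omega

/-- A smaller leave would be smaller by at least 8 and so have fewer than three edges. Then it is
empty, and the given leave has exactly 8 edges, which is excluded. -/
lemma IsPacking.isMaximumPacking_of_odd {𝒞 : Finset (Finset (Sym2 V))} (h : IsPacking 𝒞)
    (hV : Odd (Fintype.card V)) (hl : (leave 𝒞).card < 11) (hl8 : (leave 𝒞).card ≠ 8) :
    IsMaximumPacking 𝒞 := by
  refine ⟨h, fun 𝒟 h𝒟 => ?_⟩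
  have := h.card_leave
  have := h𝒟.card_leave
  rcases h𝒟.leave_eq_empty_or_three_le hV with h0 | h3
  · rw [← Finset.card_eq_zero] at h0
    omega
  · omega

end CyclePacking

/-! ### Rigid pairs and unions of packings -/

namespace CyclePacking

variable {V : Type*}

/-- The edges of the complete graph on `S`. -/
def clique (S : Finset V) : Set (Sym2 V) :=
  {e | ¬ e.IsDiag ∧ ∀ x ∈ e, x ∈ S}

/-- The edges of the complete bipartite graph with parts `A` and `B`. -/
def cross (A B : Finset V) : Set (Sym2 V) :=
  {e | ∃ a ∈ A, ∃ b ∈ B, s(a, b) = e}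

/-- `k` edge-disjoint `8`-cycles can be packed into the edge set `H`. -/
def Packs (H : Set (Sym2 V)) (k : ℕ) [DecidableEq V] : Prop :=
  ∃ 𝒞 : Finset (Finset (Sym2 V)), IsPacking 𝒞 ∧ (∀ C ∈ 𝒞, (C : Set (Sym2 V)) ⊆ H) ∧ 𝒞.card = k

/-- The cycle of `𝒞` through the edge `uv` is the only one that contains both `u` and `v`. -/
def IsRigidPair (𝒞 : Finset (Finset (Sym2 V))) (u v : V) : Prop :=
  (∃ C ∈ 𝒞, s(u, v) ∈ C) ∧ ∀ C ∈ 𝒞, u ∈ vertexSet C → v ∈ vertexSet C → s(u, v) ∈ C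

/-- `k` edge-disjoint `8`-cycles with the rigid pair `u`, `v` can be packed into `H`. -/
def PacksRigidly (H : Set (Sym2 V)) (k : ℕ) (u v : V) [DecidableEq V] : Prop :=
  ∃ 𝒞 : Finset (Finset (Sym2 V)), IsPacking 𝒞 ∧ (∀ C ∈ 𝒞, (C : Set (Sym2 V)) ⊆ H) ∧ 𝒞.card = k ∧
    IsRigidPair 𝒞 u v

variable [DecidableEq V]

lemma not_isAlmostTwoPerfect_of_isRigidPair [Fintype V] {𝒞 : Finset (Finset (Sym2 V))}
    (h : IsPacking 𝒞) {u v : V} (huv : IsRigidPair 𝒞 u v) : ¬ IsAlmostTwoPerfect 𝒞 := by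
  rintro ⟨f, hf, hpack, hleave⟩
  obtain ⟨⟨C₀, hC₀, he₀⟩, hrigid⟩ := huv
  have hleave' : s(u, v) ∉ leave (𝒞.image f) := by
    rw [hleave, leave, Finset.mem_sdiff, not_and, not_not]
    exact fun _ => Finset.mem_biUnion.2 ⟨C₀, hC₀, he₀⟩
  rw [leave, Finset.mem_sdiff, not_and, not_not] at hleave'
  have := hleave' (by simpa using (h.1 C₀ hC₀).not_isDiag he₀)
  obtain ⟨D, hD, heD⟩ := Finset.mem_biUnion.1 this
  obtain ⟨C, hC, rfl⟩ := Finset.mem_image.1 hD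
  obtain ⟨-, hvert, hdisj⟩ := hf C hC
  have heC : s(u, v) ∈ C := hrigid C hC
    (hvert ▸ ⟨_, heD, Sym2.mem_mk_left _ _⟩) (hvert ▸ ⟨_, heD, Sym2.mem_mk_right _ _⟩)
  exact Finset.disjoint_left.1 hdisj heC heD

lemma IsPacking.union {𝒞 𝒟 : Finset (Finset (Sym2 V))} {H K : Set (Sym2 V)} (h𝒞 : IsPacking 𝒞)
    (h𝒟 : IsPacking 𝒟) (hH : ∀ C ∈ 𝒞, (C : Set (Sym2 V)) ⊆ H)
    (hK : ∀ C ∈ 𝒟, (C : Set (Sym2 V)) ⊆ K) (hHK : Disjoint H K) :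
    IsPacking (𝒞 ∪ 𝒟) ∧ (∀ C ∈ 𝒞 ∪ 𝒟, (C : Set (Sym2 V)) ⊆ H ∪ K) ∧
      (𝒞 ∪ 𝒟).card = 𝒞.card + 𝒟.card := by
  have hdisj : ∀ C ∈ 𝒞, ∀ D ∈ 𝒟, Disjoint C D := fun C hC D hD =>
    Finset.disjoint_coe.1 (hHK.mono (hH C hC) (hK D hD))
  refine ⟨⟨?_, ?_⟩, ?_, ?_⟩
  · intro C hC
    rcases Finset.mem_union.1 hC with hC | hC
    exacts [h𝒞.1 C hC, h𝒟.1 C hC]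
  · intro C hC D hD hne
    rcases Finset.mem_union.1 hC with hC | hC <;> rcases Finset.mem_union.1 hD with hD | hD
    exacts [h𝒞.2 C hC D hD hne, hdisj C hC D hD, (hdisj D hD C hC).symm, h𝒟.2 C hC D hD hne]
  · intro C hC
    rcases Finset.mem_union.1 hC with hC | hC
    exacts [(hH C hC).trans Set.subset_union_left, (hK C hC).trans Set.subset_union_right]
  · refine Finset.card_union_of_disjoint (Finset.disjoint_left.2 fun C hC hC' => ?_)
    -- A common cycle would be disjoint from itself, hence empty, but it has 8 edges.
    have h0 := hdisj C hC C hC'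
    have h8 := (h𝒞.1 C hC).card_eq
    rw [disjoint_self.1 h0] at h8
    simp at h8

lemma Packs.union {H K : Set (Sym2 V)} {k l : ℕ} (hH : Packs H k) (hK : Packs K l)
    (hHK : Disjoint H K) : Packs (H ∪ K) (k + l) := by
  obtain ⟨𝒞, h1, h2, rfl⟩ := hH
  obtain ⟨𝒟, h3, h4, rfl⟩ := hK
  exact ⟨_, h1.union h3 h2 h4 hHK⟩

/-- Rigidity survives because the added cycles all miss `u` or all miss `v`. -/
lemma PacksRigidly.union {H K : Set (Sym2 V)} {k l : ℕ} {u v : V} (hH : PacksRigidly H k u v)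
    (hK : Packs K l) (hHK : Disjoint H K) (huv : (∀ e ∈ K, u ∉ e) ∨ ∀ e ∈ K, v ∉ e) :
    PacksRigidly (H ∪ K) (k + l) u v := by
  obtain ⟨𝒞, h1, h2, rfl, ⟨C₀, hC₀, he₀⟩, hr⟩ := hH
  obtain ⟨𝒟, h3, h4, rfl⟩ := hK
  obtain ⟨h5, h6, h7⟩ := h1.union h3 h2 h4 hHK
  refine ⟨_, h5, h6, h7, ⟨C₀, Finset.mem_union_left _ hC₀, he₀⟩, fun C hC hu hv => ?_⟩
  rcases Finset.mem_union.1 hC with hC | hC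
  · exact hr C hC hu hv
  · obtain ⟨e, he, hue⟩ := hu
    obtain ⟨e', he', hve⟩ := hv
    rcases huv with h | h
    · exact absurd hue (h e (h4 C hC he))
    · exact absurd hve (h e' (h4 C hC he'))

lemma Packs.mono {H K : Set (Sym2 V)} {k : ℕ} (h : Packs H k) (hHK : H ⊆ K) : Packs K k := by
  obtain ⟨𝒞, h1, h2, h3⟩ := h
  exact ⟨𝒞, h1, fun C hC => (h2 C hC).trans hHK, h3⟩

lemma PacksRigidly.mono {H K : Set (Sym2 V)} {k : ℕ} {u v : V} (h : PacksRigidly H k u v)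
    (hHK : H ⊆ K) : PacksRigidly K k u v := by
  obtain ⟨𝒞, h1, h2, h3⟩ := h
  exact ⟨𝒞, h1, fun C hC => (h2 C hC).trans hHK, h3⟩

/-! ### Verification of explicit packings by computation -/

section Tables

/-- `k n`, with a case distinction on `n` that makes the kernel evaluate `n` first. -/
def applyEvaluated {α : Type*} (n : ℕ) (k : ℕ → α) : α :=
  match n with
  | 0 => k 0
  | n + 1 => k (n + 1)

lemma applyEvaluated_eq {α : Type*} (n : ℕ) (k : ℕ → α) : applyEvaluated n k = k n := by
  cases n <;> rfl

/-- Tests that the list has no repetitions and no entries among the binary digits of `used`. -/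
def avoidsRepeats : List ℕ → ℕ → Bool
  | [], _ => true
  | c :: cs, used =>
    !used.testBit c && applyEvaluated (used ||| 1 <<< c) fun used' => avoidsRepeats cs used'

lemma avoidsRepeats_spec (cs : List ℕ) (used : ℕ) (h : avoidsRepeats cs used = true) :
    cs.Nodup ∧ ∀ c ∈ cs, used.testBit c = false := by
  induction cs generalizing used with
  | nil => simp
  | cons c cs ih =>
    rw [avoidsRepeats, applyEvaluated_eq, Bool.and_eq_true] at h
    obtain ⟨h1, h2⟩ := ih _ h.2
    simp only [Nat.testBit_or, Bool.or_eq_false_iff] at h2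
    refine ⟨List.nodup_cons.2 ⟨fun hc => ?_, h1⟩, ?_⟩
    · have := (h2 c hc).2
      simp [Nat.testBit_shiftLeft] at this
    · intro d hd
      rcases List.mem_cons.1 hd with rfl | hd
      · simpa using h.1
      · exact (h2 d hd).1

variable {m : ℕ} [NeZero m]

/-- The closed walk of length `8` through the first eight entries of a list. -/
def walk (l : List (Fin m)) (i : Fin 8) : Fin m := l.getD i 0

/-- The vertices of the closed walk of a list. -/
def walkVertices (l : List (Fin m)) : List (Fin m) := (List.finRange 8).map (walk l)

/-- A number that determines the pair of `a` and `b`, for `m ≤ 32`. -/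
def pairCode {m : ℕ} (a b : Fin m) : ℕ :=
  bif Nat.ble a.val b.val then 32 * a.val + b.val else 32 * b.val + a.val

/-- The codes of the edges of the closed walk of a list. -/
def walkCodes (l : List (Fin m)) : List ℕ :=
  (List.finRange 8).map fun i => pairCode (walk l i) (walk l (i + 1))

/-- The closed walks in the table are cycles and share no edges. -/
def IsCycleTable (T : List (List (Fin m))) : Prop :=
  (∀ l ∈ T, (walkVertices l).Nodup) ∧ avoidsRepeats (T.flatMap walkCodes) 0 = true

instance (T : List (List (Fin m))) : Decidable (IsCycleTable T) :=
  inferInstanceAs (Decidable (_ ∧ _))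

/-- For `m ≤ 32` the smaller and the larger endpoint are the two digits of the code in base 32. -/
lemma pairCode_eq_iff {m : ℕ} (hm : m ≤ 32) {a b c d : Fin m} :
    pairCode a b = pairCode c d ↔ s(a, b) = s(c, d) := by
  simp only [Sym2.eq_iff, pairCode, cond_eq_ite, Nat.ble_eq, Fin.ext_iff]
  split_ifs <;> omega

variable (φ : Fin m ↪ V)

/-- The `8`-cycles of a table, relabelled. -/
def tableCycles (T : List (List (Fin m))) : Finset (Finset (Sym2 V)) :=
  (T.map fun l => cycleEdges (φ ∘ walk l)).toFinset

lemma mem_tableCycles {T : List (List (Fin m))} {C : Finset (Sym2 V)} :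
    C ∈ tableCycles φ T ↔ ∃ l ∈ T, cycleEdges (φ ∘ walk l) = C := by
  simp [tableCycles]

lemma pairCode_mem_walkCodes (hm : m ≤ 32) {l : List (Fin m)} {a b : Fin m} :
    pairCode a b ∈ walkCodes l ↔ s(φ a, φ b) ∈ cycleEdges (φ ∘ walk l) := by
  simp only [walkCodes, List.mem_map, List.mem_finRange, true_and, pairCode_eq_iff hm,
    mem_cycleEdges, Function.comp_apply]
  refine exists_congr fun i => ?_
  exact (Sym2.map.injective φ.injective).eq_iff.symm

lemma IsCycleTable.isPacking (hm : m ≤ 32) {T : List (List (Fin m))} (hT : IsCycleTable T) :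
    IsPacking (tableCycles φ T) ∧ (tableCycles φ T).card = T.length := by
  obtain ⟨hnodup, hcodes⟩ := hT
  replace hcodes := (avoidsRepeats_spec _ _ hcodes).1
  have hcyc : ∀ l ∈ T, IsEightCycle (cycleEdges (φ ∘ walk l)) := fun l hl =>
    ⟨_, φ.injective.comp (List.nodup_map_iff_inj_on (List.nodup_finRange 8) |>.1 (hnodup l hl) |>
      fun h i j hij => h i (List.mem_finRange i) j (List.mem_finRange j) hij), rfl⟩
  have hpw : T.Pairwise fun l l' =>
      Disjoint (cycleEdges (φ ∘ walk l)) (cycleEdges (φ ∘ walk l')) := by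
    refine (List.nodup_flatMap.1 hcodes).2.imp fun {l l'} h => ?_
    refine Finset.disjoint_left.2 fun e he he' => ?_
    obtain ⟨i, rfl⟩ := mem_cycleEdges.1 he
    exact h ((pairCode_mem_walkCodes φ hm).2 he) ((pairCode_mem_walkCodes φ hm).2 he')
  refine ⟨⟨?_, ?_⟩, ?_⟩
  · intro C hC
    obtain ⟨l, hl, rfl⟩ := (mem_tableCycles φ).1 hC
    exact hcyc l hl
  · intro C hC D hD hne
    obtain ⟨l, hl, rfl⟩ := (mem_tableCycles φ).1 hC
    obtain ⟨l', hl', rfl⟩ := (mem_tableCycles φ).1 hD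
    have : Std.Symm fun l l' : List (Fin m) =>
        Disjoint (cycleEdges (φ ∘ walk l)) (cycleEdges (φ ∘ walk l')) := ⟨fun _ _ h => h.symm⟩
    exact hpw.forall hl hl' fun h => hne (by rw [h])
  · rw [tableCycles, List.toFinset_card_of_nodup, List.length_map]
    rw [List.nodup_iff_pairwise_ne, List.pairwise_map]
    refine hpw.imp_of_mem fun {l l'} hl _ h heq => ?_
    have h8 := (hcyc l hl).card_eq
    rw [← heq, disjoint_self] at h
    rw [h] at h8
    simp at h8

lemma IsCycleTable.packs (hm : m ≤ 32) {T : List (List (Fin m))} (hT : IsCycleTable T)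
    {H : Set (Sym2 V)} (hH : ∀ l ∈ T, ∀ i, s(φ (walk l i), φ (walk l (i + 1))) ∈ H) :
    Packs H T.length := by
  refine ⟨_, (hT.isPacking φ hm).1, fun C hC e he => ?_, (hT.isPacking φ hm).2⟩
  obtain ⟨l, hl, rfl⟩ := (mem_tableCycles φ).1 hC
  obtain ⟨i, rfl⟩ := mem_cycleEdges.1 he
  exact hH l hl i

lemma exists_embedding_of_card {V : Type*} {m : ℕ} {S : Finset V} (hS : S.card = m) :
    ∃ φ : Fin m ↪ V, ∀ v, v ∈ S ↔ ∃ i, φ i = v := by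
  refine ⟨(S.equivFinOfCardEq hS).symm.toEmbedding.trans (Function.Embedding.subtype _),
    fun v => ⟨fun hv => ⟨S.equivFinOfCardEq hS ⟨v, hv⟩, by simp⟩, ?_⟩⟩
  rintro ⟨i, rfl⟩
  simp

lemma IsCycleTable.edge_mem_clique {V : Type*} (φ : Fin m ↪ V) {T : List (List (Fin m))}
    (hT : IsCycleTable T) {S : Finset V} (hφ : ∀ v, v ∈ S ↔ ∃ i, φ i = v) :
    ∀ l ∈ T, ∀ i, s(φ (walk l i), φ (walk l (i + 1))) ∈ clique S := by
  intro l hl i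
  refine ⟨fun h => ?_, fun x hx => ?_⟩
  · have := List.inj_on_of_nodup_map (hT.1 l hl) (List.mem_finRange i) (List.mem_finRange (i + 1))
      (φ.injective h)
    omega
  · rw [hφ]
    rcases Sym2.mem_iff.1 hx with rfl | rfl
    exacts [⟨_, rfl⟩, ⟨_, rfl⟩]

lemma IsCycleTable.packs_clique (hm : m ≤ 32) {T : List (List (Fin m))} (hT : IsCycleTable T)
    {S : Finset V} (hS : S.card = m) : Packs (clique S) T.length := by
  obtain ⟨φ, hφ⟩ := exists_embedding_of_card hS
  exact hT.packs φ hm (hT.edge_mem_clique φ hφ)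

lemma IsCycleTable.packsRigidly_clique (hm : m ≤ 32) {T : List (List (Fin m))}
    (hT : IsCycleTable T) (h01 : ∃ l ∈ T, pairCode (0 : Fin m) 1 ∈ walkCodes l)
    (hrigid : ∀ l ∈ T, 0 ∈ walkVertices l → 1 ∈ walkVertices l →
      pairCode (0 : Fin m) 1 ∈ walkCodes l)
    {S : Finset V} (hS : S.card = m) :
    ∃ u ∈ S, ∃ v ∈ S, PacksRigidly (clique S) T.length u v := by
  obtain ⟨φ, hφ⟩ := exists_embedding_of_card hS
  have hvert : ∀ (l : List (Fin m)) a, φ a ∈ vertexSet (cycleEdges (φ ∘ walk l)) →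
      a ∈ walkVertices l := by
    intro l a ha
    obtain ⟨i, hi⟩ := mem_vertexSet_cycleEdges.1 ha
    exact List.mem_map.2 ⟨i, List.mem_finRange i, φ.injective hi⟩
  refine ⟨φ 0, (hφ _).2 ⟨0, rfl⟩, φ 1, (hφ _).2 ⟨1, rfl⟩, _, (hT.isPacking φ hm).1,
    fun C hC e he => ?_, (hT.isPacking φ hm).2, ?_, fun C hC h0 h1 => ?_⟩
  · obtain ⟨l, hl, rfl⟩ := (mem_tableCycles φ).1 hC
    obtain ⟨i, rfl⟩ := mem_cycleEdges.1 he
    exact hT.edge_mem_clique φ hφ l hl i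
  · obtain ⟨l, hl, h⟩ := h01
    exact ⟨_, (mem_tableCycles φ).2 ⟨l, hl, rfl⟩, (pairCode_mem_walkCodes φ hm).1 h⟩
  · obtain ⟨l, hl, rfl⟩ := (mem_tableCycles φ).1 hC
    exact (pairCode_mem_walkCodes φ hm).1 (hrigid l hl (hvert l 0 h0) (hvert l 1 h1))

end Tables

end CyclePacking

/-! ### Packings of small order with a rigid pair -/

namespace CyclePacking

/-- Edge-disjoint `8`-cycles in the complete graph on 11 vertices with the rigid pair `0`, `1`. -/
def table11 : List (List (Fin 11)) :=
  [[0, 1, 3, 5, 9, 6, 4, 7], [3, 10, 7, 9, 2, 8, 6, 0], [10, 6, 3, 8, 9, 0, 2, 4],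
   [3, 7, 8, 1, 2, 6, 5, 4], [10, 5, 1, 6, 7, 2, 3, 9], [8, 10, 2, 5, 7, 1, 9, 4]]

/-- Edge-disjoint `8`-cycles in the complete graph on 12 vertices with the rigid pair `0`, `1`. -/
def table12 : List (List (Fin 12)) :=
  [[0, 1, 11, 4, 5, 10, 3, 2], [2, 10, 1, 6, 11, 5, 9, 8], [3, 9, 1, 5, 7, 4, 10, 6],
   [10, 8, 0, 4, 6, 7, 9, 11], [5, 0, 10, 9, 4, 3, 11, 2], [9, 2, 7, 0, 3, 5, 8, 6],
   [0, 11, 7, 3, 8, 4, 2, 6]]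

/-- Edge-disjoint `8`-cycles in the complete graph on 13 vertices with the rigid pair `0`, `1`. -/
def table13 : List (List (Fin 13)) :=
  [[0, 1, 12, 9, 11, 5, 4, 7], [12, 0, 4, 6, 5, 2, 9, 7], [2, 6, 7, 10, 8, 3, 1, 11],
   [5, 8, 1, 9, 10, 11, 6, 12], [8, 0, 6, 10, 2, 4, 12, 11], [8, 12, 2, 7, 1, 10, 3, 6],
   [1, 2, 8, 9, 4, 3, 7, 5], [1, 6, 9, 3, 11, 7, 8, 4], [3, 5, 9, 0, 11, 4, 10, 12]]

/-- Edge-disjoint `8`-cycles in the complete graph on 14 vertices with the rigid pair `0`, `1`. -/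
def table14 : List (List (Fin 14)) :=
  [[0, 1, 11, 12, 13, 3, 5, 4], [11, 4, 6, 10, 12, 5, 7, 0], [4, 10, 3, 2, 12, 1, 7, 9],
   [6, 5, 1, 4, 13, 9, 2, 11], [6, 2, 10, 0, 8, 11, 3, 9], [5, 13, 8, 6, 7, 3, 1, 9],
   [5, 0, 9, 11, 10, 8, 4, 2], [6, 0, 13, 10, 5, 8, 3, 12], [12, 9, 8, 2, 1, 10, 7, 4],
   [13, 11, 7, 8, 12, 0, 3, 6]]

/-- Edge-disjoint `8`-cycles in the complete graph on 15 vertices with the rigid pair `0`, `1`. -/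
def table15 : List (List (Fin 15)) :=
  [[0, 1, 12, 10, 8, 2, 7, 11], [0, 9, 4, 14, 12, 2, 10, 7], [13, 0, 12, 4, 6, 11, 9, 14],
   [8, 0, 4, 2, 13, 9, 10, 11], [5, 4, 1, 11, 14, 8, 13, 7], [8, 7, 4, 11, 12, 13, 6, 1],
   [11, 5, 14, 6, 12, 9, 7, 3], [8, 5, 3, 12, 7, 1, 2, 6], [4, 10, 3, 2, 14, 1, 5, 13],
   [0, 10, 5, 12, 8, 9, 3, 6], [2, 11, 13, 3, 1, 10, 6, 9], [1, 13, 10, 14, 7, 6, 5, 9]]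

/-- Edge-disjoint `8`-cycles in the complete graph on 16 vertices with the rigid pair `0`, `1`. -/
def table16 : List (List (Fin 16)) :=
  [[0, 1, 11, 9, 5, 2, 14, 6], [4, 7, 11, 12, 10, 2, 1, 8], [3, 15, 5, 11, 6, 9, 14, 0],
   [15, 11, 10, 8, 6, 2, 12, 0], [4, 14, 1, 7, 8, 12, 3, 9], [8, 3, 11, 13, 14, 15, 1, 5],
   [4, 10, 3, 13, 6, 15, 9, 0], [12, 1, 10, 9, 8, 2, 7, 6], [0, 11, 2, 3, 7, 10, 13, 5],
   [12, 5, 4, 13, 0, 8, 14, 7], [6, 3, 1, 9, 13, 7, 15, 4], [15, 10, 5, 7, 9, 12, 13, 2],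
   [15, 13, 1, 4, 12, 14, 11, 8], [14, 3, 4, 2, 0, 10, 6, 5]]

/-- Edge-disjoint `8`-cycles in the complete graph on 17 vertices with the rigid pair `0`, `1`. -/
def table17 : List (List (Fin 17)) :=
  [[0, 1, 12, 16, 3, 5, 9, 2], [16, 4, 12, 5, 7, 2, 10, 13], [9, 1, 2, 3, 7, 11, 13, 8],
   [3, 1, 8, 4, 2, 15, 13, 6], [4, 7, 6, 1, 16, 5, 11, 15], [6, 8, 3, 0, 9, 13, 7, 12],
   [10, 8, 16, 0, 7, 15, 14, 5], [6, 0, 4, 14, 2, 12, 15, 5], [14, 16, 6, 15, 0, 5, 8, 12],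
   [1, 14, 6, 11, 8, 15, 9, 10], [7, 10, 11, 9, 3, 12, 0, 8], [11, 4, 9, 16, 10, 0, 13, 3],
   [13, 1, 11, 14, 7, 16, 2, 5], [10, 3, 4, 6, 9, 12, 13, 14], [10, 6, 2, 8, 14, 0, 11, 12],
   [10, 15, 3, 14, 9, 7, 1, 4], [15, 16, 11, 2, 13, 4, 5, 1]]

/-- Edge-disjoint `8`-cycles in the complete graph on 18 vertices with the rigid pair `0`, `1`. -/
def table18 : List (List (Fin 18)) :=
  [[0, 1, 11, 7, 5, 8, 17, 10], [8, 6, 17, 16, 5, 15, 1, 10], [10, 11, 14, 16, 2, 15, 8, 9],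
   [17, 7, 2, 1, 8, 16, 9, 14], [13, 6, 5, 0, 17, 2, 4, 15], [12, 13, 4, 10, 16, 0, 15, 14],
   [5, 10, 14, 4, 1, 12, 11, 2], [11, 4, 5, 9, 15, 10, 7, 3], [9, 0, 4, 7, 8, 11, 13, 17],
   [13, 0, 6, 11, 17, 4, 8, 2], [16, 1, 13, 3, 2, 6, 9, 11], [11, 0, 2, 12, 6, 7, 14, 5],
   [2, 9, 3, 4, 12, 17, 1, 14], [13, 9, 7, 16, 15, 6, 3, 5], [5, 12, 7, 0, 8, 3, 15, 17],
   [4, 16, 12, 10, 3, 0, 14, 6], [8, 13, 14, 3, 1, 7, 15, 12], [10, 13, 16, 3, 12, 9, 1, 6]]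

/-- Edge-disjoint `8`-cycles in the complete graph on 19 vertices with the rigid pair `0`, `1`. -/
def table19 : List (List (Fin 19)) :=
  [[0, 1, 12, 18, 3, 14, 2, 8], [5, 16, 7, 17, 4, 13, 14, 15], [4, 18, 15, 6, 12, 10, 14, 16],
   [16, 3, 1, 17, 13, 15, 11, 6], [8, 9, 1, 13, 18, 14, 7, 4], [15, 2, 4, 0, 6, 5, 17, 10],
   [16, 1, 7, 2, 10, 18, 17, 15], [13, 0, 5, 18, 11, 4, 3, 9], [11, 3, 10, 16, 18, 9, 14, 1],
   [14, 12, 7, 13, 16, 9, 10, 8], [1, 5, 12, 16, 17, 3, 13, 10], [4, 15, 7, 6, 3, 12, 13, 5],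
   [1, 6, 4, 10, 11, 2, 12, 8], [8, 13, 6, 18, 7, 9, 0, 3], [17, 2, 3, 5, 14, 0, 16, 11],
   [2, 0, 10, 5, 7, 8, 11, 13], [6, 9, 11, 5, 2, 1, 4, 14], [1, 18, 2, 6, 8, 5, 9, 15],
   [10, 7, 11, 12, 15, 0, 17, 6], [12, 0, 18, 8, 16, 2, 9, 4], [14, 11, 0, 7, 3, 15, 8, 17]]

/-- Edge-disjoint `8`-cycles in the complete graph on 21 vertices with the rigid pair `0`, `1`. -/
def table21 : List (List (Fin 21)) :=
  [[0, 1, 12, 4, 5, 16, 9, 14], [11, 9, 19, 5, 10, 18, 2, 6], [0, 15, 8, 3, 20, 7, 12, 16],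
   [5, 17, 11, 12, 13, 16, 19, 14], [14, 1, 20, 17, 6, 15, 18, 12], [11, 18, 5, 15, 9, 8, 17, 19],
   [12, 20, 9, 3, 17, 7, 14, 6], [12, 17, 16, 18, 6, 0, 3, 2], [2, 1, 6, 19, 13, 10, 16, 7],
   [19, 20, 10, 7, 9, 4, 17, 0], [12, 19, 8, 11, 5, 13, 18, 0], [4, 2, 8, 10, 6, 9, 18, 1],
   [3, 11, 7, 5, 9, 1, 17, 10], [13, 2, 0, 11, 16, 14, 3, 15], [8, 16, 4, 0, 9, 13, 20, 14],
   [16, 15, 2, 14, 4, 20, 11, 1], [6, 8, 1, 13, 14, 15, 11, 4], [1, 10, 11, 2, 16, 20, 5, 3],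
   [8, 7, 6, 16, 3, 13, 4, 18], [11, 14, 18, 3, 4, 7, 0, 13], [1, 15, 7, 19, 4, 10, 2, 5],
   [3, 19, 2, 9, 12, 8, 13, 6], [6, 5, 12, 10, 14, 17, 2, 20], [5, 0, 20, 18, 19, 15, 4, 8],
   [13, 17, 9, 10, 15, 12, 3, 7]]

/-- Edge-disjoint `8`-cycles in the complete graph on 23 vertices with the rigid pair `0`, `1`. -/
def table23 : List (List (Fin 23)) :=
  [[0, 1, 12, 18, 21, 5, 7, 14], [8, 21, 22, 10, 14, 15, 3, 19], [17, 4, 13, 22, 11, 21, 3, 5],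
   [20, 22, 16, 8, 3, 1, 5, 12], [6, 20, 15, 9, 22, 19, 12, 21], [13, 7, 18, 20, 10, 19, 17, 14],
   [11, 19, 0, 16, 4, 21, 10, 7], [10, 13, 12, 16, 3, 9, 20, 4], [18, 9, 5, 0, 20, 13, 19, 4],
   [0, 9, 19, 7, 8, 11, 18, 15], [18, 2, 21, 20, 1, 15, 4, 14], [6, 3, 11, 2, 0, 4, 7, 22],
   [11, 4, 1, 17, 20, 3, 22, 15], [18, 5, 10, 2, 22, 12, 15, 8], [0, 12, 8, 2, 20, 19, 6, 11],
   [12, 3, 10, 16, 9, 6, 13, 2], [3, 0, 21, 9, 17, 22, 5, 2], [13, 18, 16, 7, 12, 9, 11, 17],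
   [6, 0, 17, 15, 21, 13, 8, 10], [8, 17, 6, 15, 2, 1, 21, 14], [4, 3, 7, 2, 16, 11, 1, 22],
   [0, 10, 15, 16, 19, 21, 17, 7], [11, 10, 1, 16, 5, 6, 14, 12], [1, 13, 5, 8, 6, 12, 10, 18],
   [5, 14, 1, 7, 21, 16, 6, 4], [11, 5, 19, 2, 17, 16, 14, 20], [14, 2, 9, 13, 15, 19, 18, 22],
   [20, 5, 15, 7, 6, 18, 0, 8], [12, 4, 9, 14, 11, 13, 3, 17], [16, 13, 0, 22, 8, 9, 7, 20],
   [9, 10, 17, 18, 3, 14, 19, 1]]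

/-- Edge-disjoint `8`-cycles in the complete graph on 25 vertices with the rigid pair `0`, `1`. -/
def table25 : List (List (Fin 25)) :=
  [[0, 1, 24, 11, 16, 9, 10, 18], [8, 6, 18, 14, 24, 23, 16, 22], [7, 6, 12, 14, 9, 18, 22, 10],
   [23, 19, 24, 15, 1, 10, 13, 8], [6, 4, 19, 16, 10, 15, 21, 5], [2, 23, 20, 10, 19, 7, 5, 24],
   [12, 7, 20, 1, 23, 9, 15, 17], [22, 24, 17, 20, 14, 13, 11, 9], [9, 5, 12, 8, 1, 16, 14, 7],
   [10, 21, 23, 3, 24, 9, 0, 11], [1, 9, 3, 18, 5, 8, 2, 13], [3, 2, 5, 1, 7, 13, 12, 10],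
   [14, 0, 8, 7, 4, 15, 20, 5], [21, 24, 0, 13, 9, 19, 8, 20], [6, 16, 13, 20, 0, 22, 3, 11],
   [4, 20, 2, 7, 15, 6, 23, 5], [12, 23, 4, 14, 15, 0, 5, 19], [0, 16, 2, 12, 24, 18, 13, 19],
   [0, 10, 6, 22, 20, 9, 17, 2], [16, 17, 13, 21, 2, 18, 15, 8], [6, 13, 15, 22, 4, 16, 18, 17],
   [5, 22, 2, 4, 0, 3, 15, 11], [14, 8, 4, 3, 5, 13, 24, 10], [17, 14, 6, 24, 4, 11, 21, 7],
   [10, 17, 8, 21, 0, 23, 18, 4], [4, 12, 20, 24, 16, 7, 0, 17], [6, 19, 17, 22, 12, 16, 3, 21],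
   [14, 2, 11, 20, 19, 22, 1, 3], [11, 14, 19, 1, 18, 20, 3, 17], [8, 24, 7, 22, 14, 1, 4, 9],
   [11, 1, 21, 19, 15, 5, 10, 8], [21, 17, 5, 16, 15, 23, 11, 18], [23, 22, 13, 3, 12, 15, 2, 10],
   [9, 6, 3, 7, 23, 13, 4, 21], [11, 22, 21, 16, 20, 6, 1, 12], [3, 8, 18, 12, 0, 6, 2, 19],
   [1, 2, 9, 12, 21, 14, 23, 17]]

variable {V : Type*} [DecidableEq V]

variable (V) in
/-- Every complete graph on `n` vertices has a packing with `k` cycles that has a rigid pair. -/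
def RigidlyPackable (n k : ℕ) : Prop :=
  ∀ S : Finset V, S.card = n → ∃ u ∈ S, ∃ v ∈ S, PacksRigidly (clique S) k u v

lemma rigidlyPackable_11 : RigidlyPackable V 11 6 := fun _ hS =>
  IsCycleTable.packsRigidly_clique (T := table11) (by norm_num) (by decide +kernel)
    (by decide +kernel) (by decide +kernel) hS

lemma rigidlyPackable_12 : RigidlyPackable V 12 7 := fun _ hS =>
  IsCycleTable.packsRigidly_clique (T := table12) (by norm_num) (by decide +kernel)
    (by decide +kernel) (by decide +kernel) hS

lemma rigidlyPackable_13 : RigidlyPackable V 13 9 := fun _ hS =>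
  IsCycleTable.packsRigidly_clique (T := table13) (by norm_num) (by decide +kernel)
    (by decide +kernel) (by decide +kernel) hS

lemma rigidlyPackable_14 : RigidlyPackable V 14 10 := fun _ hS =>
  IsCycleTable.packsRigidly_clique (T := table14) (by norm_num) (by decide +kernel)
    (by decide +kernel) (by decide +kernel) hS

lemma rigidlyPackable_15 : RigidlyPackable V 15 12 := fun _ hS =>
  IsCycleTable.packsRigidly_clique (T := table15) (by norm_num) (by decide +kernel)
    (by decide +kernel) (by decide +kernel) hS

lemma rigidlyPackable_16 : RigidlyPackable V 16 14 := fun _ hS =>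
  IsCycleTable.packsRigidly_clique (T := table16) (by norm_num) (by decide +kernel)
    (by decide +kernel) (by decide +kernel) hS

lemma rigidlyPackable_17 : RigidlyPackable V 17 17 := fun _ hS =>
  IsCycleTable.packsRigidly_clique (T := table17) (by norm_num) (by decide +kernel)
    (by decide +kernel) (by decide +kernel) hS

lemma rigidlyPackable_18 : RigidlyPackable V 18 18 := fun _ hS =>
  IsCycleTable.packsRigidly_clique (T := table18) (by norm_num) (by decide +kernel)
    (by decide +kernel) (by decide +kernel) hS

lemma rigidlyPackable_19 : RigidlyPackable V 19 21 := fun _ hS =>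
  IsCycleTable.packsRigidly_clique (T := table19) (by norm_num) (by decide +kernel)
    (by decide +kernel) (by decide +kernel) hS

lemma rigidlyPackable_21 : RigidlyPackable V 21 25 := fun _ hS =>
  IsCycleTable.packsRigidly_clique (T := table21) (by norm_num) (by decide +kernel)
    (by decide +kernel) (by decide +kernel) hS

lemma rigidlyPackable_23 : RigidlyPackable V 23 31 := fun _ hS =>
  IsCycleTable.packsRigidly_clique (T := table23) (by norm_num) (by decide +kernel)
    (by decide +kernel) (by decide +kernel) hS

lemma rigidlyPackable_25 : RigidlyPackable V 25 37 := fun _ hS =>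
  IsCycleTable.packsRigidly_clique (T := table25) (by norm_num) (by decide +kernel)
    (by decide +kernel) (by decide +kernel) hS

end CyclePacking

/-! ### Bipartite decompositions and the recursion -/

namespace CyclePacking

/-- Two edge-disjoint `8`-cycles in `K_{4,4}` with parts `{0, 1, 2, 3}` and `{4, 5, 6, 7}`. -/
def tableBipartite44 : List (List (Fin 8)) :=
  [[0, 4, 1, 5, 2, 6, 3, 7], [0, 5, 3, 4, 2, 7, 1, 6]]

/-- Three edge-disjoint `8`-cycles in `K_{4,6}` with parts `{0, 1, 2, 3}` and `{4, …, 9}`. -/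
def tableBipartite46 : List (List (Fin 10)) :=
  [[0, 4, 1, 5, 2, 6, 3, 7], [0, 5, 3, 4, 2, 8, 1, 9], [0, 6, 1, 7, 2, 9, 3, 8]]

/-- Three edge-disjoint `8`-cycles in `K_8`. -/
def table8 : List (List (Fin 8)) :=
  [[0, 2, 1, 3, 4, 6, 5, 7], [0, 3, 5, 1, 6, 2, 7, 4], [0, 5, 2, 4, 1, 7, 3, 6]]

section Hosts

variable {V : Type*}

lemma disjoint_clique_clique {S T : Finset V} {w : V} (h : ∀ x ∈ S, x ∈ T → x = w) :
    Disjoint (clique S) (clique T) := by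
  refine Set.disjoint_left.2 fun e he he' => ?_
  induction e with | _ a b
  refine he.1 ?_
  rw [Sym2.mk_isDiag_iff,
    h a (he.2 a (Sym2.mem_mk_left _ _)) (he'.2 a (Sym2.mem_mk_left _ _)),
    h b (he.2 b (Sym2.mem_mk_right _ _)) (he'.2 b (Sym2.mem_mk_right _ _))]

lemma disjoint_clique_cross {S A B : Finset V} (h : Disjoint S B) :
    Disjoint (clique S) (cross A B) := by
  refine Set.disjoint_left.2 fun e he => ?_
  rintro ⟨a, -, b, hb, rfl⟩
  exact Finset.disjoint_left.1 h (he.2 b (Sym2.mem_mk_right _ _)) hb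

lemma cross_comm (A B : Finset V) : cross A B = cross B A := by
  ext e
  constructor <;> rintro ⟨a, ha, b, hb, rfl⟩ <;> exact ⟨b, hb, a, ha, Sym2.eq_swap⟩

lemma disjoint_cross_cross {A A' B : Finset V} (hA : Disjoint A A') (hB : Disjoint A B) :
    Disjoint (cross A B) (cross A' B) := by
  refine Set.disjoint_left.2 ?_
  rintro e ⟨a, ha, b, hb, rfl⟩ ⟨a', ha', b', hb', heq⟩
  rcases Sym2.eq_iff.1 heq with ⟨rfl, -⟩ | ⟨-, rfl⟩
  · exact Finset.disjoint_left.1 hA ha ha'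
  · exact Finset.disjoint_left.1 hB ha hb'

lemma clique_mono {S T : Finset V} (h : S ⊆ T) : clique S ⊆ clique T :=
  fun _ he => ⟨he.1, fun x hx => h (he.2 x hx)⟩

lemma cross_subset_clique {A B S : Finset V} (hA : A ⊆ S) (hB : B ⊆ S) (h : Disjoint A B) :
    cross A B ⊆ clique S := by
  rintro e ⟨a, ha, b, hb, rfl⟩
  refine ⟨fun hab => ?_, fun x hx => ?_⟩
  · obtain rfl : a = b := hab
    exact Finset.disjoint_left.1 h ha hb
  · rcases Sym2.mem_iff.1 hx with rfl | rfl
    exacts [hA ha, hB hb]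

lemma not_mem_of_mem_cross {A B : Finset V} {v : V} (hA : v ∉ A) (hB : v ∉ B) :
    ∀ e ∈ cross A B, v ∉ e := by
  rintro e ⟨a, ha, b, hb, rfl⟩ hv
  rcases Sym2.mem_iff.1 hv with rfl | rfl
  exacts [hA ha, hB hb]

lemma not_mem_of_mem_clique {S : Finset V} {v : V} (hS : v ∉ S) : ∀ e ∈ clique S, v ∉ e :=
  fun _ he hv => hS (he.2 v hv)

variable [DecidableEq V]

lemma cross_union_left (A A' B : Finset V) : cross (A ∪ A') B = cross A B ∪ cross A' B := by
  ext e
  simp only [cross, Finset.mem_union, Set.mem_union, Set.mem_ofPred_eq, or_and_right, exists_or]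

lemma PacksRigidly.ne {S : Finset V} {k : ℕ} {u v : V} (h : PacksRigidly (clique S) k u v) :
    u ≠ v := by
  obtain ⟨𝒞, -, h2, -, ⟨C, hC, he⟩, -⟩ := h
  exact (h2 C hC he).1

lemma IsCycleTable.packs_cross {m : ℕ} [NeZero m] (hm : m ≤ 32) {T : List (List (Fin m))}
    (hT : IsCycleTable T) (h4 : ∀ l ∈ T, ∀ i, (walk l i).val < 4 ↔ ¬ (walk l (i + 1)).val < 4)
    {A B : Finset V} (hA : A.card = 4) (hB : B.card = m - 4) (hAB : Disjoint A B) :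
    Packs (cross A B) T.length := by
  obtain ⟨φ, hφ⟩ := exists_embedding_of_card hA
  obtain ⟨ψ, hψ⟩ := exists_embedding_of_card hB
  have hne : ∀ i j, φ i ≠ ψ j := fun i j h =>
    Finset.disjoint_left.1 hAB ((hφ _).2 ⟨i, rfl⟩) ((hψ _).2 ⟨j, h.symm⟩)
  -- Labels below 4 go to `A`, the others to `B`; by `h4` the walks alternate between the two parts.
  let χ : Fin m ↪ V :=
    ⟨fun i => if h : i.val < 4 then φ ⟨i, h⟩ else ψ ⟨i - 4, by omega⟩, fun i j hij => by
      dsimp only at hij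
      split_ifs at hij with hi hj hj
      · simpa [Fin.ext_iff] using hij
      · exact absurd hij (hne _ _)
      · exact absurd hij.symm (hne _ _)
      · have := congrArg Fin.val (ψ.injective hij)
        dsimp only at this
        omega⟩
  have hχA : ∀ i : Fin m, i.val < 4 → χ i ∈ A := fun i hi =>
    (hφ _).2 ⟨⟨i, hi⟩, by change _ = dite _ _ _; rw [dif_pos hi]⟩
  have hχB : ∀ i : Fin m, ¬ i.val < 4 → χ i ∈ B := fun i hi =>
    (hψ _).2 ⟨⟨i - 4, by omega⟩, by change _ = dite _ _ _; rw [dif_neg hi]⟩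
  refine hT.packs χ hm fun l hl i => ?_
  by_cases h : (walk l i).val < 4
  · exact ⟨_, hχA _ h, _, hχB _ ((h4 l hl i).1 h), rfl⟩
  · exact ⟨_, hχA _ (by_contra fun h' => h ((h4 l hl i).2 h')), _, hχB _ h, Sym2.eq_swap⟩

/-- Splitting off four vertices of `A` at a time reduces to `K_{4,4}` and `K_{6,4}`. The count `n /
2` means that all `4 * n` edges are used. -/
lemma packs_cross_four {n : ℕ} (hn : Even n) (h4 : 4 ≤ n) {A B : Finset V} (hA : A.card = n)
    (hB : B.card = 4) (hAB : Disjoint A B) : Packs (cross A B) (n / 2) := by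
  induction n using Nat.strong_induction_on generalizing A with
  | _ n ih =>
    rcases (by grind : n = 4 ∨ n = 6 ∨ 8 ≤ n) with rfl | rfl | h8
    · rw [cross_comm]
      exact IsCycleTable.packs_cross (T := tableBipartite44) (by norm_num) (by decide +kernel)
        (by decide +kernel) hB hA hAB.symm
    · rw [cross_comm]
      exact IsCycleTable.packs_cross (T := tableBipartite46) (by norm_num) (by decide +kernel)
        (by decide +kernel) hB hA hAB.symm
    · obtain ⟨A', hA', hcard⟩ := Finset.exists_subset_card_eq (s := A) (n := 4) (by omega)
      have hsd : (A \ A').card = n - 4 := by rw [Finset.card_sdiff_of_subset hA']; omega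
      have h1 := ih 4 (by omega) (by decide) le_rfl hcard (hAB.mono_left hA')
      have h2 := ih (n - 4) (by omega) (by grind) (by omega) hsd
        (hAB.mono_left Finset.sdiff_subset)
      have h3 := h1.union h2 (disjoint_cross_cross Finset.disjoint_sdiff (hAB.mono_left hA'))
      rw [← cross_union_left, Finset.union_sdiff_of_subset hA'] at h3
      convert h3 using 1
      omega

lemma packs_cross {n j : ℕ} (hn : Even n) (h4 : 4 ≤ n) {A B : Finset V} (hA : A.card = n)
    (hB : B.card = 4 * j) (hAB : Disjoint A B) : Packs (cross A B) (n / 2 * j) := by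
  induction j generalizing B with
  | zero => exact ⟨∅, ⟨by simp, by simp⟩, by simp, by simp⟩
  | succ j ih =>
    obtain ⟨B', hB', hcard⟩ := Finset.exists_subset_card_eq (s := B) (n := 4) (by omega)
    have hsd : (B \ B').card = 4 * j := by rw [Finset.card_sdiff_of_subset hB']; omega
    have h1 := ih hsd (hAB.mono_right Finset.sdiff_subset)
    have h2 := packs_cross_four hn h4 hA hcard (hAB.mono_right hB')
    rw [cross_comm] at h1 h2
    have h3 := h1.union h2 (disjoint_cross_cross Finset.sdiff_disjoint
      (hAB.symm.mono_left Finset.sdiff_subset))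
    rw [← cross_union_left, Finset.sdiff_union_of_subset hB', cross_comm] at h3
    exact h3

end Hosts

variable {V : Type*} [DecidableEq V]

/-- The 17 cycles use all 136 edges of `K_17`, which is why 16 vertices are added for odd orders. -/
lemma packs_clique_17 {S : Finset V} (hS : S.card = 17) : Packs (clique S) 17 :=
  IsCycleTable.packs_clique (T := table17) (by norm_num) (by decide +kernel) hS

lemma packs_clique_8 {S : Finset V} (hS : S.card = 8) : Packs (clique S) 3 :=
  IsCycleTable.packs_clique (T := table8) (by norm_num) (by decide +kernel) hS

/-- The new edges form `K_17` on `B` and the vertex `u`, and the bipartite graph between `A` without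
`u` and `B`. Both decompose completely, so the leave keeps its size. Cycles of the former miss `v`,
those of the latter miss `u`. -/
lemma RigidlyPackable.add_sixteen {n k : ℕ} (h : RigidlyPackable V n k) (hn : Odd n)
    (h5 : 5 ≤ n) : RigidlyPackable V (n + 16) (k + (n - 1) / 2 * 4 + 17) := by
  intro S hS
  obtain ⟨A, hA, hAcard⟩ := Finset.exists_subset_card_eq (s := S) (n := n) (by omega)
  have hB : (S \ A).card = 16 := by rw [Finset.card_sdiff_of_subset hA]; omega
  have hAB : Disjoint A (S \ A) := Finset.disjoint_sdiff
  generalize S \ A = B, (Finset.sdiff_subset : S \ A ⊆ S) = hBS at hB hAB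
  obtain ⟨u, hu, v, hv, h1⟩ := h A hAcard
  have huB := Finset.disjoint_left.1 hAB hu
  have hvB := Finset.disjoint_left.1 hAB hv
  have h2 : Packs (cross (A.erase u) B) ((n - 1) / 2 * 4) :=
    packs_cross (by grind) (by omega) (by rw [Finset.card_erase_of_mem hu, hAcard]) hB
      (hAB.mono_left (Finset.erase_subset _ _))
  have h3 : Packs (clique (insert u B)) 17 :=
    packs_clique_17 (by rw [Finset.card_insert_of_notMem huB, hB])
  have h12 := h1.union h2 (disjoint_clique_cross hAB)
    (Or.inl (not_mem_of_mem_cross (Finset.notMem_erase u A) huB))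
  have h123 := h12.union h3 ?_
    (Or.inr (not_mem_of_mem_clique (by simp [Finset.mem_insert, h1.ne.symm, hvB])))
  · refine ⟨u, hA hu, v, hA hv, h123.mono ?_⟩
    refine Set.union_subset (Set.union_subset (clique_mono hA) ?_) (clique_mono ?_)
    · exact cross_subset_clique ((Finset.erase_subset _ _).trans hA) hBS
        (hAB.mono_left (Finset.erase_subset _ _))
    · exact Finset.insert_subset (hA hu) hBS
  -- The two cliques share only the vertex `u`, hence no edge.
  · refine Set.disjoint_union_left.2 ⟨disjoint_clique_clique (w := u) fun x hx hx' => ?_, ?_⟩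
    · rcases Finset.mem_insert.1 hx' with rfl | hxB
      · rfl
      · exact absurd hxB (Finset.disjoint_left.1 hAB hx)
    · rw [cross_comm]
      refine (disjoint_clique_cross (Finset.disjoint_left.2 fun x hx hx' => ?_)).symm
      rcases Finset.mem_insert.1 hx with rfl | hxB
      · exact Finset.notMem_erase _ _ hx'
      · exact Finset.disjoint_left.1 hAB (Finset.mem_of_mem_erase hx') hxB

/-- The bipartite graph between `A` and `B` is decomposed in two pieces, with `u` and `v` on
different sides of the split of `A`, so no cycle of either piece meets both. Only 4 of the 28 edges
inside `B` stay uncovered. -/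
lemma RigidlyPackable.add_eight {n k : ℕ} (h : RigidlyPackable V n k) (hn : Even n)
    (h8 : 8 ≤ n) : RigidlyPackable V (n + 8) (k + n + 3) := by
  intro S hS
  obtain ⟨A, hA, hAcard⟩ := Finset.exists_subset_card_eq (s := S) (n := n) (by omega)
  have hB : (S \ A).card = 8 := by rw [Finset.card_sdiff_of_subset hA]; omega
  have hAB : Disjoint A (S \ A) := Finset.disjoint_sdiff
  generalize S \ A = B, (Finset.sdiff_subset : S \ A ⊆ S) = hBS at hB hAB
  obtain ⟨u, hu, v, hv, h1⟩ := h A hAcard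
  have huB := Finset.disjoint_left.1 hAB hu
  have hvB := Finset.disjoint_left.1 hAB hv
  obtain ⟨D, hDu, hDv, hD⟩ := Finset.exists_subsuperset_card_eq (s := {u}) (t := A.erase v) (n := 4)
    (by simpa using ⟨h1.ne, hu⟩) (by simp) (by rw [Finset.card_erase_of_mem hv]; omega)
  have hDA : D ⊆ A := hDv.trans (Finset.erase_subset _ _)
  have huD : u ∈ D := hDu (Finset.mem_singleton_self u)
  have hvD : v ∉ D := fun h => Finset.notMem_erase v A (hDv h)
  have hDB := hAB.mono_left hDA
  have hDB' : Disjoint (A \ D) B := hAB.mono_left Finset.sdiff_subset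
  have h2 : Packs (cross D B) (4 / 2 * 2) := packs_cross (by decide) le_rfl hD hB hDB
  have h3 : Packs (cross (A \ D) B) ((n - 4) / 2 * 2) :=
    packs_cross (by grind) (by omega) (by rw [Finset.card_sdiff_of_subset hDA]; omega) hB hDB'
  have h12 := h1.union h2 (disjoint_clique_cross hAB) (Or.inr (not_mem_of_mem_cross hvD hvB))
  have h123 := h12.union h3
    (Set.disjoint_union_left.2 ⟨disjoint_clique_cross hAB,
      disjoint_cross_cross Finset.disjoint_sdiff hDB⟩)
    (Or.inl (not_mem_of_mem_cross (by simp [huD]) huB))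
  have hcross : ∀ E : Finset V, Disjoint E B → Disjoint (cross E B) (clique B) := fun E hE => by
    rw [cross_comm]
    exact (disjoint_clique_cross hE.symm).symm
  have h1234 := h123.union (packs_clique_8 hB)
    (Set.disjoint_union_left.2 ⟨Set.disjoint_union_left.2
      -- `A` and `B` have no common vertex, so the choice of `w` is immaterial.
      ⟨disjoint_clique_clique (w := u) fun x hx hx' =>
        absurd hx' (Finset.disjoint_left.1 hAB hx), hcross _ hDB⟩, hcross _ hDB'⟩)
    (Or.inl (not_mem_of_mem_clique huB))
  refine ⟨u, hA hu, v, hA hv, ?_⟩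
  have hk : k + 4 / 2 * 2 + (n - 4) / 2 * 2 + 3 = k + n + 3 := by grind
  rw [hk] at h1234
  refine h1234.mono (Set.union_subset (Set.union_subset (Set.union_subset (clique_mono hA) ?_) ?_)
    (clique_mono hBS))
  · exact cross_subset_clique (hDA.trans hA) hBS hDB
  · exact cross_subset_clique (Finset.sdiff_subset.trans hA) hBS hDB'

lemma choose_two_add (n j : ℕ) : (n + j).choose 2 = n.choose 2 + j * n + j.choose 2 := by
  induction j with
  | zero => simp
  | succ j ih =>
    rw [← add_assoc, Nat.choose_succ_succ' _ 1, Nat.choose_succ_succ' _ 1, ih, Nat.choose_one_right,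
      Nat.choose_one_right]
    ring

variable (V) in
lemma exists_rigidlyPackable_of_odd (n : ℕ) (hn : Odd n) (h11 : 11 ≤ n) :
    ∃ k l, l + 8 * k = n.choose 2 ∧ l < 11 ∧ l ≠ 8 ∧ RigidlyPackable V n k := by
  induction n using Nat.strong_induction_on with
  | _ n ih =>
    rcases lt_or_ge n 27 with h | h
    -- One base case for each odd residue modulo 16.
    · rcases (by grind : n = 11 ∨ n = 13 ∨ n = 15 ∨ n = 17 ∨ n = 19 ∨ n = 21 ∨ n = 23 ∨ n = 25)
        with rfl | rfl | rfl | rfl | rfl | rfl | rfl | rfl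
      · exact ⟨_, 7, rfl, by norm_num, by norm_num, rigidlyPackable_11⟩
      · exact ⟨_, 6, rfl, by norm_num, by norm_num, rigidlyPackable_13⟩
      · exact ⟨_, 9, rfl, by norm_num, by norm_num, rigidlyPackable_15⟩
      · exact ⟨_, 0, rfl, by norm_num, by norm_num, rigidlyPackable_17⟩
      · exact ⟨_, 3, rfl, by norm_num, by norm_num, rigidlyPackable_19⟩
      · exact ⟨_, 10, rfl, by norm_num, by norm_num, rigidlyPackable_21⟩
      · exact ⟨_, 5, rfl, by norm_num, by norm_num, rigidlyPackable_23⟩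
      · exact ⟨_, 4, rfl, by norm_num, by norm_num, rigidlyPackable_25⟩
    · obtain ⟨m, rfl⟩ := Nat.exists_eq_add_of_le' (show 16 ≤ n by omega)
      have hm : Odd m := by grind
      obtain ⟨k, l, hkl, h1, h2, h3⟩ := ih m (by omega) hm (by omega)
      refine ⟨_, l, ?_, h1, h2, h3.add_sixteen hm (by omega)⟩
      rw [choose_two_add, ← hkl, show Nat.choose 16 2 = 120 from rfl]
      grind

variable (V) in
lemma exists_rigidlyPackable_of_even (n : ℕ) (hn : Even n) (h12 : 12 ≤ n) :
    ∃ k l, l + 8 * k = n.choose 2 ∧ 2 * l < n + 16 ∧ RigidlyPackable V n k := by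
  induction n using Nat.strong_induction_on with
  | _ n ih =>
    rcases lt_or_ge n 20 with h | h
    · rcases (by grind : n = 12 ∨ n = 14 ∨ n = 16 ∨ n = 18) with rfl | rfl | rfl | rfl
      · exact ⟨_, 10, rfl, by norm_num, rigidlyPackable_12⟩
      · exact ⟨_, 11, rfl, by norm_num, rigidlyPackable_14⟩
      · exact ⟨_, 8, rfl, by norm_num, rigidlyPackable_16⟩
      · exact ⟨_, 9, rfl, by norm_num, rigidlyPackable_18⟩
    · obtain ⟨m, rfl⟩ := Nat.exists_eq_add_of_le' (show 8 ≤ n by omega)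
      have hm : Even m := by grind
      obtain ⟨k, l, hkl, h1, h3⟩ := ih m (by omega) hm (by omega)
      -- The leave gains 4 edges while the order grows by 8, so both sides of the bound grow by 8.
      refine ⟨_, l + 4, ?_, by omega, h3.add_eight hm (by omega)⟩
      rw [choose_two_add, ← hkl, show Nat.choose 8 2 = 28 from rfl]
      omega

end CyclePacking

/-! ### The order 10: exhaustive search for inside cycles -/

namespace CyclePacking

section InsideCycles

variable {m : ℕ} [NeZero m]

/-- The number whose binary digits are the entries of the list. -/
def codesMask : List ℕ → ℕ
  | [] => 0
  | c :: cs => codesMask cs ||| 1 <<< c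

lemma testBit_codesMask {cs : List ℕ} {c : ℕ} : (codesMask cs).testBit c = true ↔ c ∈ cs := by
  induction cs with
  | nil => simp [codesMask]
  | cons d cs ih =>
    rw [codesMask, Nat.testBit_or, Bool.or_eq_true, ih, Nat.one_shiftLeft, Nat.testBit_two_pow,
      decide_eq_true_eq, List.mem_cons, or_comm, eq_comm]

/-- `M` together with the edges of the walk from `a` along the list and then to `start`. -/
def closingMask (start : Fin m) : Fin m → List (Fin m) → ℕ → ℕ
  | a, [], M => M ||| 1 <<< pairCode a start
  | a, b :: r, M => closingMask start b r (M ||| 1 <<< pairCode a b)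

/-- The values of `closingMask` for all walks from `a` with `k` further new vertices in `vs` and
with edges in `allowed`. -/
def closingMasks (allowed : ℕ) (vs : List (Fin m)) (start : Fin m) :
    ℕ → Fin m → List (Fin m) → ℕ → List ℕ
  | 0, a, _, M => if allowed.testBit (pairCode a start) then [M ||| 1 <<< pairCode a start] else []
  | k + 1, a, visited, M => vs.flatMap fun b =>
      if allowed.testBit (pairCode a b) && !visited.contains b then
        closingMasks allowed vs start k b (b :: visited) (M ||| 1 <<< pairCode a b) else []

/-- Completeness of the enumeration. This direction suffices, since superfluous candidates could
only make the search succeed. -/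
lemma closingMask_mem {m : ℕ} {allowed : ℕ} {vs : List (Fin m)} {start : Fin m} (r : List (Fin m))
    (a : Fin m) (visited : List (Fin m)) (M : ℕ) (hvs : ∀ x ∈ r, x ∈ vs)
    (hvisited : ∀ x ∈ r, x ∉ visited) (hr : r.Nodup)
    (hallowed : (a :: (r ++ [start])).IsChain fun x y => allowed.testBit (pairCode x y) = true) :
    closingMask start a r M ∈ closingMasks allowed vs start r.length a visited M := by
  induction r generalizing a visited M with
  | nil =>
    have : allowed.testBit (pairCode a start) = true := by simpa using hallowed
    simp [closingMask, closingMasks, this]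
  | cons b r ih =>
    rw [List.cons_append, List.isChain_cons_cons] at hallowed
    rw [List.nodup_cons] at hr
    simp only [closingMask, closingMasks, List.length_cons, List.mem_flatMap]
    refine ⟨b, hvs b List.mem_cons_self, ?_⟩
    rw [if_pos (by simpa [hallowed.1] using hvisited b List.mem_cons_self)]
    refine ih b _ _ (fun x hx => hvs x (List.mem_cons_of_mem _ hx)) (fun x hx => ?_) hr.2 hallowed.2
    rw [List.mem_cons, not_or]
    exact ⟨fun h => hr.1 (h ▸ hx), hvisited x (List.mem_cons_of_mem _ hx)⟩

/-- The edge sets, as numbers, of the inside cycles of the cycle of `l` that consist of edges of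
the cycles of the table `T`. -/
def insideMasks (T : List (List (Fin m))) (l : List (Fin m)) : List ℕ :=
  applyEvaluated (codesMask ((T.flatMap walkCodes).filter fun c => !(walkCodes l).contains c))
    fun allowed => closingMasks allowed l (walk l 0) 7 (walk l 0) [walk l 0] 0

/-- Tests whether one number can be chosen in each list such that the chosen numbers have no
common binary digits and avoid those of `used`. -/
def hasDisjointChoice : List (List ℕ) → ℕ → Bool
  | [], _ => true
  | L :: Ls, used =>
    L.any fun M => Nat.beq (M &&& used) 0 && applyEvaluated (M ||| used) (hasDisjointChoice Ls)

lemma hasDisjointChoice_map {α : Type*} {F : α → List ℕ} {g : α → ℕ} (T : List α) (used : ℕ)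
    (hg : ∀ l ∈ T, g l ∈ F l) (hT : T.Pairwise fun l l' => g l &&& g l' = 0)
    (hused : ∀ l ∈ T, g l &&& used = 0) : hasDisjointChoice (T.map F) used = true := by
  induction T generalizing used with
  | nil => rfl
  | cons l T ih =>
    rw [List.pairwise_cons] at hT
    rw [List.map_cons, hasDisjointChoice, List.any_eq_true]
    refine ⟨g l, hg l List.mem_cons_self, ?_⟩
    rw [applyEvaluated_eq, Bool.and_eq_true, Nat.beq_eq]
    refine ⟨hused l List.mem_cons_self, ih _ (fun l' h => hg l' (List.mem_cons_of_mem _ h)) hT.2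
      fun l' h => ?_⟩
    rw [Nat.and_or_distrib_left, hused l' (List.mem_cons_of_mem _ h), Nat.and_comm, hT.1 l' h]
    rfl

/-- `k L`, where the kernel evaluates the entries of `L` first. -/
def applyEvaluatedList {α : Type*} : List ℕ → (List ℕ → α) → α
  | [], k => k []
  | a :: L, k => applyEvaluated a fun a' => applyEvaluatedList L fun L' => k (a' :: L')

lemma applyEvaluatedList_eq {α : Type*} (L : List ℕ) (k : List ℕ → α) :
    applyEvaluatedList L k = k L := by
  induction L generalizing k with
  | nil => rfl
  | cons a L ih => rw [applyEvaluatedList, applyEvaluated_eq, ih]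

/-- Removes repeated entries. -/
def withoutRepeats : List ℕ → List ℕ
  | [] => []
  | a :: L => bif (withoutRepeats L).any (Nat.beq a) then withoutRepeats L else a :: withoutRepeats L

/-- An inside cycle is enumerated once for each direction of traversal, with the same mask; dropping
the repetition must not lose a candidate. -/
lemma mem_withoutRepeats {L : List ℕ} {a : ℕ} : a ∈ L → a ∈ withoutRepeats L := by
  induction L with
  | nil => exact id
  | cons b L ih =>
    intro h
    rw [withoutRepeats, cond_eq_ite]
    rcases List.mem_cons.1 h with rfl | h <;> split_ifs with hL
    · obtain ⟨c, hc, hac⟩ := List.any_eq_true.1 hL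
      exact Nat.eq_of_beq_eq_true hac ▸ hc
    · exact List.mem_cons_self
    · exact ih h
    · exact List.mem_cons_of_mem _ (ih h)

/-- `k Ls` without repetitions in the lists, where the kernel evaluates these lists first. -/
def applyEvaluatedLists {α : Type*} : List (List ℕ) → (List (List ℕ) → α) → α
  | [], k => k []
  | L :: Ls, k => applyEvaluatedList L fun L' => applyEvaluatedList (withoutRepeats L') fun L'' =>
      applyEvaluatedLists Ls fun Ls' => k (L'' :: Ls')

lemma applyEvaluatedLists_eq {α : Type*} (Ls : List (List ℕ)) (k : List (List ℕ) → α) :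
    applyEvaluatedLists Ls k = k (Ls.map withoutRepeats) := by
  induction Ls generalizing k with
  | nil => rfl
  | cons L Ls ih => rw [applyEvaluatedLists, applyEvaluatedList_eq, applyEvaluatedList_eq, ih]; rfl

/-- Allows an inside cycle to start at the vertex at which the enumeration starts. -/
lemma cycleEdges_rotate {V : Type*} [DecidableEq V] (c : Fin 8 → V) (k : Fin 8) :
    cycleEdges (fun i => c (i + k)) = cycleEdges c := by
  ext e
  rw [mem_cycleEdges, mem_cycleEdges]
  constructor
  · rintro ⟨i, rfl⟩
    exact ⟨i + k, by rw [add_right_comm]⟩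
  · rintro ⟨i, rfl⟩
    exact ⟨i - k, by rw [add_right_comm, sub_add_cancel]⟩

/-- The mask is that of `D`, traversed from `walk l 0`. For the conclusion it is enough that every
binary digit of the mask comes from an edge of `D`: disjoint cycles then have disjoint masks. -/
lemma exists_mem_insideMasks (hm : m ≤ 32) {T : List (List (Fin m))} {l : List (Fin m)}
    (hl : ∀ i, walk l i ∈ l) {D : Finset (Sym2 (Fin m))} (hD : IsInsideCycle (cycleEdges (walk l)) D)
    (hDT : ∀ e ∈ D, ∃ l' ∈ T, e ∈ cycleEdges (walk l')) :
    ∃ M ∈ insideMasks T l, ∀ c, M.testBit c = true → ∃ a b, s(a, b) ∈ D ∧ pairCode a b = c := by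
  obtain ⟨⟨d₀, hd₀, rfl⟩, hvert, hdisj⟩ := hD
  obtain ⟨k, hk⟩ : ∃ k, d₀ k = walk l 0 := by
    rw [← mem_vertexSet_cycleEdges, hvert, mem_vertexSet_cycleEdges]
    exact ⟨0, rfl⟩
  obtain ⟨d, hd, hdedges, hd0⟩ : ∃ d : Fin 8 → Fin m, Function.Injective d ∧
      cycleEdges d = cycleEdges d₀ ∧ d 0 = walk l 0 :=
    ⟨_, hd₀.comp (add_left_injective k), cycleEdges_rotate d₀ k, by simpa using hk⟩
  rw [← hdedges] at hvert hdisj hDT ⊢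
  have hmem : ∀ i, d i ∈ l := fun i => by
    obtain ⟨j, hj⟩ := mem_vertexSet_cycleEdges.1 (hvert ▸ mem_vertexSet_cycleEdges.2 ⟨i, rfl⟩)
    exact hj ▸ hl j
  have hallowed : ∀ i, (codesMask ((T.flatMap walkCodes).filter
      fun c => !(walkCodes l).contains c)).testBit (pairCode (d i) (d (i + 1))) = true := fun i => by
    have hi := mem_cycleEdges.2 (⟨i, rfl⟩ : ∃ j, s(d j, d (j + 1)) = s(d i, d (i + 1)))
    obtain ⟨l', hl', he⟩ := hDT _ hi
    rw [testBit_codesMask, List.mem_filter, List.mem_flatMap]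
    refine ⟨⟨l', hl', (pairCode_mem_walkCodes (Function.Embedding.refl _) hm).2 he⟩, ?_⟩
    have : pairCode (d i) (d (i + 1)) ∉ walkCodes l := fun h =>
      Finset.disjoint_right.1 hdisj hi
        ((pairCode_mem_walkCodes (Function.Embedding.refl _) hm).1 h)
    simpa using this
  refine ⟨closingMask (walk l 0) (walk l 0) [d 1, d 2, d 3, d 4, d 5, d 6, d 7] 0, ?_, ?_⟩
  · rw [insideMasks, applyEvaluated_eq]
    generalize codesMask _ = allowed at hallowed ⊢
    refine closingMask_mem [d 1, d 2, d 3, d 4, d 5, d 6, d 7] _ _ _ ?_ ?_ ?_ ?_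
    · simp [hmem]
    · simp [← hd0, hd.eq_iff]
    · simp [hd.eq_iff]
    · simpa [← hd0] using ⟨hallowed 0, hallowed 1, hallowed 2, hallowed 3, hallowed 4, hallowed 5,
        hallowed 6, hallowed 7⟩
  · intro c hc
    simp only [closingMask, ← hd0, Nat.testBit_or, Nat.one_shiftLeft, Nat.testBit_two_pow,
      Nat.zero_testBit, Bool.or_eq_true, decide_eq_true_eq, Bool.false_eq_true, false_or] at hc
    have hex : ∀ i, pairCode (d i) (d (i + 1)) = c →
        ∃ a b, s(a, b) ∈ cycleEdges d ∧ pairCode a b = c :=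
      fun i hi => ⟨_, _, mem_cycleEdges.2 ⟨i, rfl⟩, hi⟩
    rcases hc with ((((((hc | hc) | hc) | hc) | hc) | hc) | hc) | hc
    exacts [hex 0 hc, hex 1 hc, hex 2 hc, hex 3 hc, hex 4 hc, hex 5 hc, hex 6 hc, hex 7 hc]

lemma IsPacking.biUnion_eq_of_leave_eq {V : Type*} [DecidableEq V] [Fintype V]
    {𝒞 𝒟 : Finset (Finset (Sym2 V))} (h𝒞 : IsPacking 𝒞) (h𝒟 : IsPacking 𝒟)
    (h : leave 𝒞 = leave 𝒟) : 𝒞.biUnion id = 𝒟.biUnion id := by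
  rw [← Finset.sdiff_sdiff_eq_self h𝒞.biUnion_subset, ← Finset.sdiff_sdiff_eq_self h𝒟.biUnion_subset]
  exact congrArg _ h

/-- Equal leaves mean equal sets of covered edges, so the chosen inside cycles use only edges of the
table. Their masks would be a disjoint choice, which the search rules out. -/
lemma not_isAlmostTwoPerfect_of_table (hm : m ≤ 32) {T : List (List (Fin m))}
    (hT : IsCycleTable T) (hwalk : ∀ l ∈ T, ∀ i, walk l i ∈ l)
    (hsearch : applyEvaluatedLists (T.map (insideMasks T)) (fun Ls => hasDisjointChoice Ls 0)
      = false) :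
    ¬ IsAlmostTwoPerfect (tableCycles (Function.Embedding.refl (Fin m)) T) := by
  rintro ⟨f, hf, hpack, hleave⟩
  obtain ⟨hpack₀, hcard⟩ := hT.isPacking (Function.Embedding.refl (Fin m)) hm
  have hunion := hpack.biUnion_eq_of_leave_eq hpack₀ hleave
  have hinj : Set.InjOn f (tableCycles (Function.Embedding.refl (Fin m)) T) := by
    rw [← Finset.card_image_iff]
    -- Both packings cover equally many edges, eight per cycle, so `f` identifies no two cycles.
    have := congrArg Finset.card hunion
    rw [hpack.card_biUnion, hpack₀.card_biUnion] at this
    omega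
  have hmemT : ∀ l ∈ T, cycleEdges (walk l) ∈ tableCycles (Function.Embedding.refl (Fin m)) T :=
    fun l hl => (mem_tableCycles _).2 ⟨l, hl, rfl⟩
  have hmask : ∀ l ∈ T, ∃ M ∈ insideMasks T l, ∀ c, M.testBit c = true →
      ∃ a b, s(a, b) ∈ f (cycleEdges (walk l)) ∧ pairCode a b = c := by
    intro l hl
    refine exists_mem_insideMasks hm (hwalk l hl) (hf _ (hmemT l hl)) fun e he => ?_
    have : e ∈ (tableCycles (Function.Embedding.refl (Fin m)) T).biUnion id := by
      rw [← hunion]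
      exact Finset.mem_biUnion.2 ⟨_, Finset.mem_image_of_mem f (hmemT l hl), he⟩
    obtain ⟨C, hC, he⟩ := Finset.mem_biUnion.1 this
    obtain ⟨l', hl', rfl⟩ := (mem_tableCycles _).1 hC
    exact ⟨l', hl', he⟩
  have hpw : T.Pairwise fun l l' => cycleEdges (walk l) ≠ cycleEdges (walk l') := by
    have hnodup : (T.map fun l => cycleEdges (walk l)).Nodup := by
      rw [← Multiset.coe_nodup, ← Multiset.toFinset_card_eq_card_iff_nodup, Multiset.coe_card,
        List.length_map]
      exact hcard
    rwa [List.nodup_iff_pairwise_ne, List.pairwise_map] at hnodup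
  choose! g hg hgbit using hmask
  rw [applyEvaluatedLists_eq, List.map_map, hasDisjointChoice_map (g := g)] at hsearch
  · exact absurd hsearch (by simp)
  · exact fun l hl => mem_withoutRepeats (hg l hl)
  · refine hpw.imp_of_mem fun {l l'} hl hl' hne => Nat.eq_of_testBit_eq fun c => ?_
    have hdisj := hpack.2 _ (Finset.mem_image_of_mem f (hmemT l hl)) _
      (Finset.mem_image_of_mem f (hmemT l' hl')) (hinj.ne (hmemT l hl) (hmemT l' hl') hne)
    rw [Nat.testBit_and, Nat.zero_testBit, ← Bool.not_eq_true, Bool.and_eq_true]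
    rintro ⟨h, h'⟩
    obtain ⟨a, b, hab, rfl⟩ := hgbit l hl c h
    obtain ⟨a', b', hab', hc⟩ := hgbit l' hl' _ h'
    rw [pairCode_eq_iff hm] at hc
    exact Finset.disjoint_left.1 hdisj hab (hc ▸ hab')
  · simp

end InsideCycles

/-- Five edge-disjoint `8`-cycles in `K_{10}`. -/
def table10 : List (List (Fin 10)) :=
  [[4, 6, 0, 3, 5, 7, 1, 2], [6, 8, 7, 0, 5, 1, 4, 9], [0, 2, 6, 1, 9, 7, 3, 8],
   [0, 4, 3, 1, 8, 2, 5, 9], [7, 4, 8, 5, 6, 3, 9, 2]]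

lemma isCycleTable_table10 : IsCycleTable table10 := by decide +kernel

/-- Rigid pairs cannot help here: the leave has 5 edges and meets all ten vertices, so it is a
perfect matching. Every vertex then lies on 4 of the 5 cycles, and any two vertices share at least
3. -/
lemma not_isAlmostTwoPerfect_table10 :
    ¬ IsAlmostTwoPerfect (tableCycles (Function.Embedding.refl (Fin 10)) table10) :=
  not_isAlmostTwoPerfect_of_table (by norm_num) isCycleTable_table10 (by decide +kernel)
    (by decide +kernel)

end CyclePacking

/-- For every `n ≥ 10` there is a maximum packing of the complete graph on `n` vertices with
`8`-cycles that is not almost `2`-perfect. -/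
theorem mainTheorem2 (n : ℕ) (hn : 10 ≤ n) :
    ∃ 𝒞 : Finset (Finset (Sym2 (Fin n))),
      CyclePacking.IsMaximumPacking 𝒞 ∧ ¬ CyclePacking.IsAlmostTwoPerfect 𝒞 := by
  open CyclePacking in
  rcases Nat.even_or_odd n with heven | hodd
  · rcases (by grind : n = 10 ∨ 12 ≤ n) with rfl | h12
    · obtain ⟨hpack, hcard⟩ :=
        isCycleTable_table10.isPacking (Function.Embedding.refl (Fin 10)) (by norm_num)
      refine ⟨_, hpack.isMaximumPacking_of_even (by simpa using heven) ?_,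
        not_isAlmostTwoPerfect_table10⟩
      have hleave := hpack.card_leave
      rw [hcard, Fintype.card_fin, show Nat.choose 10 2 = 45 from rfl,
        show table10.length = 5 from rfl] at hleave
      rw [Fintype.card_fin]
      omega
    · obtain ⟨k, l, hkl, hl, hrigid⟩ := exists_rigidlyPackable_of_even (Fin n) n heven h12
      obtain ⟨u, -, v, -, 𝒞, hpack, -, hcard, huv⟩ := hrigid Finset.univ (by simp)
      have hleave := hpack.card_leave
      rw [hcard, Fintype.card_fin, ← hkl] at hleave
      exact ⟨𝒞, hpack.isMaximumPacking_of_even (by simpa using heven)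
        (by rw [Fintype.card_fin]; omega), not_isAlmostTwoPerfect_of_isRigidPair hpack huv⟩
  · obtain ⟨k, l, hkl, hl, hl8, hrigid⟩ := exists_rigidlyPackable_of_odd (Fin n) n hodd (by grind)
    obtain ⟨u, -, v, -, 𝒞, hpack, -, hcard, huv⟩ := hrigid Finset.univ (by simp)
    have hleave := hpack.card_leave
    rw [hcard, Fintype.card_fin, ← hkl] at hleave
    exact ⟨𝒞, hpack.isMaximumPacking_of_odd (by simpa using hodd) (by omega) (by omega),
      not_isAlmostTwoPerfect_of_isRigidPair hpack huv⟩
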